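/- Let $d\ge 1$. For probability measures $\mu,\nu$ on $\mathbb R^d$ with finite second moments let $\Pi(\mu,\nu)$ be the set of probability measures on $\mathbb R^d\times\mathbb R^d$ with first marginal $\mu$ and second marginal $\nu$, and let $$W_2^2(\mu,\nu)=\inf_{\gamma\in\Pi(\mu,\nu)}\int\|y_0-y_1\|^2\,d\gamma(y_0,y_1).$$ A finite Gaussian mixture on $\mathbb R^n$ is a probability measure $\sum_{k=1}^K\pi^k\,\mathcal N(m^k,\Sigma^k)$ with $K\ge 1$, $\pi^k\ge 0$, $\sum_k\pi^k=1$, $m^k\in\mathbb R^n$ and $\Sigma^k$ symmetric positive semidefinite (possibly singular, so that Dirac masses are allowed as components). For finite Gaussian mixtures $\mu,\nu$ on $\mathbb R^d$ let $MW_2^2(\mu,\nu)$ be the infimum of the same integral over those $\gamma\in\Pi(\mu,\nu)$ that are finite Gaussian mixtures on $\mathbb R^d\times\mathbb R^d=\mathbb R^{2d}$. Let $\mu_i=\sum_{k=1}^{K_i}\pi_i^k\,\mathcal N(m_i^k,\Sigma_i^k)$, $i=0,1$, be two finite Gaussian mixtures on $\mathbb R^d$. Then $W_2(\mu_0,\mu_1)$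 and $MW_2(\mu_0,\mu_1)$ are finite and $$W_2(\mu_0,\mu_1)\le MW_2(\mu_0,\mu_1)\le W_2(\mu_0,\mu_1)+\sum_{i=0,1}\Bigl(2\sum_{k=1}^{K_i}\pi_i^k\,\mathrm{tr}(\Sigma_i^k)\Bigr)^{1/2}.$$ Moreover $W_2(\mu_0,\mu_1)=MW_2(\mu_0,\mu_1)$ in each of the following cases: 1. $\mu_0$ and $\mu_1$ are both Gaussian measures; 2. $\mu_0$ and $\mu_1$ are both finite convex combinations of Dirac masses; 3. $\mu_1=T_\#\mu_0$ is the image of $\mu_0$ under an affine map $T(x)=Ax+b$ whose linear part $A$ is symmetric positive semidefinite. -/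

import Mathlib

open MeasureTheory ProbabilityTheory
open scoped ENNReal

/-- `γ` is a coupling (transport plan) of `μ` and `ν`: its two marginals are `μ` and `ν`. When `μ` is
a probability measure, so is `γ`. -/
def IsCoupling {E : Type*} [MeasurableSpace E] (γ : Measure (E × E)) (μ ν : Measure E) : Prop :=
  γ.map Prod.fst = μ ∧ γ.map Prod.snd = ν

/-- `μ` is a finite Gaussian mixture: a convex combination of finitely many, possibly degenerate,
Gaussian measures. The definition makes sense on `ℝ^d` and on `ℝ^d × ℝ^d = ℝ^{2d}` alike. -/
def IsGaussianMixture {F : Type*} [TopologicalSpace F] [AddCommMonoid F] [Module ℝ F]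
    [MeasurableSpace F] (μ : Measure F) : Prop :=
  ∃ (K : ℕ) (p : Fin K → ℝ) (c : Fin K → Measure F),
    p ∈ stdSimplex ℝ (Fin K) ∧ (∀ k, IsGaussian (c k)) ∧ μ = ∑ k, ENNReal.ofReal (p k) • c k

/-- `μ` is a finite combination of Dirac masses. -/
def IsDiracMixture {E : Type*} [MeasurableSpace E] (μ : Measure E) : Prop :=
  ∃ (K : ℕ) (p : Fin K → ℝ) (y : Fin K → E),
    p ∈ stdSimplex ℝ (Fin K) ∧ μ = ∑ k, ENNReal.ofReal (p k) • Measure.dirac (y k)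

noncomputable section

/-- The quadratic transport cost of a plan, `∫ ‖y₀ - y₁‖² dγ(y₀, y₁)`, with values in `[0, ∞]`. -/
def quadCost {d : ℕ} (γ : Measure (EuclideanSpace ℝ (Fin d) × EuclideanSpace ℝ (Fin d))) : ℝ≥0∞ :=
  ∫⁻ y, ‖y.1 - y.2‖ₑ ^ 2 ∂γ

/-- The 2-Wasserstein distance on `ℝ^d`. -/
def W2 {d : ℕ} (μ ν : Measure (EuclideanSpace ℝ (Fin d))) : ℝ≥0∞ :=
  (⨅ γ ∈ {γ | IsCoupling γ μ ν}, quadCost γ) ^ (1 / 2 : ℝ)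

/-- The mixture Wasserstein distance on `ℝ^d`: as `W2`, but only over the couplings that are
finite Gaussian mixtures on `ℝ^d × ℝ^d`. -/
def MW2 {d : ℕ} (μ ν : Measure (EuclideanSpace ℝ (Fin d))) : ℝ≥0∞ :=
  (⨅ γ ∈ {γ | IsCoupling γ μ ν ∧ IsGaussianMixture γ}, quadCost γ) ^ (1 / 2 : ℝ)

/-- The Gaussian mixture `∑ k, p k • 𝒩(m k, S k)` on `ℝ^d`. -/
def gaussianMixture {d K : ℕ} (p : Fin K → ℝ) (m : Fin K → EuclideanSpace ℝ (Fin d))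
    (S : Fin K → Matrix (Fin d) (Fin d) ℝ) : Measure (EuclideanSpace ℝ (Fin d)) :=
  ∑ k, ENNReal.ofReal (p k) • multivariateGaussian (m k) (S k)

end

/-!
Take a coupling `(x₀, x₁)` of the two mixtures. Given `xᵢ`, draw a component of `μᵢ` from its
conditional law, and then a new point `yᵢ` from that component. The law of `yᵢ` is again `μᵢ`, and
the law of `(y₀, y₁)` is a mixture of products of components, hence a Gaussian mixture. Given the
component, `xᵢ` and `yᵢ` are independent draws from it, so their mean squared distance is twice the
trace of its covariance. The upper bound on `MW2` is then Minkowski's inequality along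
`y₀, x₀, x₁, y₁`.

The cost of a coupling depends only on its mean and covariance, so a coupling of two Gaussians can
be replaced by the Gaussian with the same mean and covariance, whose marginals are the same. A
coupling of two combinations of Dirac masses is itself one. An affine map with symmetric positive
semidefinite linear part is the gradient of a convex quadratic function, so by Kantorovich duality
its graph is an optimal coupling, and it transports a Gaussian mixture to a Gaussian mixture.
-/

section Couplings

variable {E : Type*} [MeasurableSpace E] {μ ν : Measure E} {γ : Measure (E × E)}

lemma IsCoupling.isProbabilityMeasure [IsProbabilityMeasure μ] (h : IsCoupling γ μ ν) :
    IsProbabilityMeasure γ := by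
  have : IsProbabilityMeasure (γ.map Prod.fst) := h.1 ▸ inferInstance
  exact Measure.isProbabilityMeasure_of_map Prod.fst

lemma isCoupling_prod [IsProbabilityMeasure μ] [IsProbabilityMeasure ν] :
    IsCoupling (μ.prod ν) μ ν :=
  ⟨by simp [Measure.map_fst_prod], by simp [Measure.map_snd_prod]⟩

lemma isCoupling_graph {T : E → E} (hT : Measurable T) :
    IsCoupling (μ.map fun x => (x, T x)) μ (μ.map T) :=
  ⟨(Measure.fst_map_prodMk hT).trans Measure.map_id, Measure.snd_map_prodMk measurable_id⟩

lemma IsCoupling.ae_fst (h : IsCoupling γ μ ν) {p : E → Prop} (hp : ∀ᵐ x ∂μ, p x) :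
    ∀ᵐ z ∂γ, p z.1 :=
  ae_of_ae_map measurable_fst.aemeasurable (by rwa [h.1])

lemma IsCoupling.ae_snd (h : IsCoupling γ μ ν) {p : E → Prop} (hp : ∀ᵐ y ∂ν, p y) :
    ∀ᵐ z ∂γ, p z.2 :=
  ae_of_ae_map measurable_snd.aemeasurable (by rwa [h.2])

lemma IsCoupling.memLp_id {E : Type*} [NormedAddCommGroup E] [MeasurableSpace E] [BorelSpace E]
    [SecondCountableTopology E] {μ ν : Measure E} {γ : Measure (E × E)} (h : IsCoupling γ μ ν)
    {p : ℝ≥0∞} (hμ : MemLp id p μ) (hν : MemLp id p ν) : MemLp id p γ := by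
  rw [← h.1, memLp_map_measure_iff (by fun_prop) (by fun_prop)] at hμ
  rw [← h.2, memLp_map_measure_iff (by fun_prop) (by fun_prop)] at hν
  exact memLp_prod_iff.2 ⟨hμ, hν⟩

end Couplings

section Resampling

variable {X X' Y Y' : Type*} [MeasurableSpace X] [MeasurableSpace X'] [MeasurableSpace Y]
  [MeasurableSpace Y']

lemma map_compProd_parallelComp_fst (γ : Measure (X × Y)) [SFinite γ] (κ : Kernel X X')
    (η : Kernel Y Y') [IsSFiniteKernel κ] [IsMarkovKernel η] :
    (γ ⊗ₘ (κ ∥ₖ η)).map (fun t => (t.1.1, t.2.1)) = γ.fst ⊗ₘ κ := by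
  refine Measure.ext_of_lintegral _ fun f hf => ?_
  rw [lintegral_map hf (by fun_prop), Measure.lintegral_compProd (by fun_prop),
    Measure.lintegral_compProd hf, Measure.fst, lintegral_map (by fun_prop) measurable_fst]
  refine lintegral_congr fun z => ?_
  rw [Kernel.lintegral_parallelComp z (by fun_prop)]
  simp

lemma map_compProd_parallelComp_snd (γ : Measure (X × Y)) [SFinite γ] (κ : Kernel X X')
    (η : Kernel Y Y') [IsMarkovKernel κ] [IsSFiniteKernel η] :
    (γ ⊗ₘ (κ ∥ₖ η)).map (fun t => (t.1.2, t.2.2)) = γ.snd ⊗ₘ η := by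
  refine Measure.ext_of_lintegral _ fun f hf => ?_
  rw [lintegral_map hf (by fun_prop), Measure.lintegral_compProd (by fun_prop),
    Measure.lintegral_compProd hf, Measure.snd, lintegral_map (by fun_prop) measurable_snd]
  refine lintegral_congr fun z => ?_
  rw [Kernel.lintegral_parallelComp_symm z (by fun_prop)]
  simp

lemma IsCoupling.parallelComp_comp {μ ν : Measure X} {γ : Measure (X × X)} [SFinite γ]
    (h : IsCoupling γ μ ν) (κ η : Kernel X Y) [IsMarkovKernel κ] [IsMarkovKernel η] :
    IsCoupling ((κ ∥ₖ η) ∘ₘ γ) (κ ∘ₘ μ) (η ∘ₘ ν) := by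
  rw [← Measure.snd_compProd, ← h.1, ← h.2]
  constructor
  · change _ = κ ∘ₘ γ.fst
    rw [← Measure.snd_compProd, ← map_compProd_parallelComp_fst γ κ η, Measure.snd, Measure.snd,
      Measure.map_map (by fun_prop) (by fun_prop), Measure.map_map (by fun_prop) (by fun_prop)]
    rfl
  · change _ = η ∘ₘ γ.snd
    rw [← Measure.snd_compProd, ← map_compProd_parallelComp_snd γ κ η, Measure.snd, Measure.snd,
      Measure.map_map (by fun_prop) (by fun_prop), Measure.map_map (by fun_prop) (by fun_prop)]
    rfl

-- The triangle inequality along `y₀, x₀, x₁, y₁`, where `(x₀, x₁)` has law `γ`.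
theorem eLpNorm_sub_parallelComp_comp_le {E : Type*} [NormedAddCommGroup E] [MeasurableSpace E]
    [BorelSpace E] [SecondCountableTopology E] {p : ℝ≥0∞} (hp : 1 ≤ p) (γ : Measure (E × E))
    [SFinite γ] (κ η : Kernel E E) [IsMarkovKernel κ] [IsMarkovKernel η] :
    eLpNorm (fun z => z.1 - z.2) p ((κ ∥ₖ η) ∘ₘ γ) ≤ eLpNorm (fun z => z.1 - z.2) p γ
      + (eLpNorm (fun z => z.1 - z.2) p (γ.fst ⊗ₘ κ)
        + eLpNorm (fun z => z.1 - z.2) p (γ.snd ⊗ₘ η)) := by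
  set π := γ ⊗ₘ (κ ∥ₖ η)
  have hx : eLpNorm (fun z => z.1 - z.2) p γ = eLpNorm (fun t => t.1.1 - t.1.2) p π := by
    rw [← Measure.fst_compProd γ (κ ∥ₖ η)]
    exact eLpNorm_map_measure (by fun_prop) (by fun_prop)
  have hy : eLpNorm (fun z => z.1 - z.2) p ((κ ∥ₖ η) ∘ₘ γ)
      = eLpNorm (fun t => t.2.1 - t.2.2) p π := by
    rw [← Measure.snd_compProd]
    exact eLpNorm_map_measure (by fun_prop) (by fun_prop)
  have hfst : eLpNorm (fun z => z.1 - z.2) p (γ.fst ⊗ₘ κ)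
      = eLpNorm (fun t => t.1.1 - t.2.1) p π := by
    rw [← map_compProd_parallelComp_fst γ κ η]
    exact eLpNorm_map_measure (by fun_prop) (by fun_prop)
  have hsnd : eLpNorm (fun z => z.1 - z.2) p (γ.snd ⊗ₘ η)
      = eLpNorm (fun t => t.1.2 - t.2.2) p π := by
    rw [← map_compProd_parallelComp_snd γ κ η]
    exact eLpNorm_map_measure (by fun_prop) (by fun_prop)
  have hpath : (fun t : (E × E) × E × E => t.2.1 - t.2.2) = (fun t => t.1.1 - t.1.2)
      + (-(fun t => t.1.1 - t.2.1) + fun t => t.1.2 - t.2.2) := by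
    ext t
    simp only [Pi.add_apply, Pi.neg_apply]
    abel
  rw [hx, hy, hfst, hsnd, hpath]
  refine (eLpNorm_add_le (by fun_prop) (by fun_prop) hp).trans ?_
  gcongr
  exact (eLpNorm_add_le (by fun_prop) (by fun_prop) hp).trans_eq (by rw [eLpNorm_neg])

end Resampling

section Posterior

variable {ι X : Type*} [MeasurableSpace ι] [StandardBorelSpace ι] [Nonempty ι] [MeasurableSpace X]
  (a : Measure ι) [IsFiniteMeasure a] (κ : Kernel ι X)

lemma compProd_comp_posterior [IsFiniteKernel κ] :
    (κ ∘ₘ a) ⊗ₘ (κ ∘ₖ κ†a) = (κ ×ₖ κ) ∘ₘ a := by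
  rw [← Measure.parallelComp_comp_compProd, compProd_posterior_eq_swap_comp,
    Measure.compProd_eq_comp_prod, Measure.comp_assoc (μ := a), Kernel.swap_prod,
    Measure.comp_assoc, Kernel.parallelComp_comp_prod, Kernel.comp_id, Kernel.id_comp]

lemma comp_comp_posterior [IsMarkovKernel κ] : (κ ∘ₖ κ†a) ∘ₘ (κ ∘ₘ a) = κ ∘ₘ a := by
  rw [← Measure.comp_assoc, posterior_comp_self]

end Posterior

section Mixtures

variable {F : Type*} [MeasurableSpace F]

/-- The law on a finite type which gives the label `i` the probability `p i`, for `p` in the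
standard simplex. A mixture with weights `p` and components `κ i` is `κ ∘ₘ labelLaw p`. -/
noncomputable def labelLaw {ι : Type*} [Fintype ι] [MeasurableSpace ι] (p : ι → ℝ) : Measure ι :=
  ∑ i, ENNReal.ofReal (p i) • Measure.dirac i

lemma isProbabilityMeasure_labelLaw {ι : Type*} [Fintype ι] [MeasurableSpace ι] {p : ι → ℝ}
    (hp : p ∈ stdSimplex ℝ ι) : IsProbabilityMeasure (labelLaw p) := by
  refine ⟨?_⟩
  simp only [labelLaw, Measure.finsetSum_apply, Measure.smul_apply, measure_univ, smul_eq_mul,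
    mul_one]
  rw [← ENNReal.ofReal_sum_of_nonneg fun i _ => hp.1 i, hp.2, ENNReal.ofReal_one]

lemma lintegral_labelLaw {ι : Type*} [Fintype ι] [MeasurableSpace ι] [MeasurableSingletonClass ι]
    (p : ι → ℝ) (f : ι → ℝ≥0∞) :
    ∫⁻ i, f i ∂(labelLaw p) = ∑ i, ENNReal.ofReal (p i) * f i := by
  simp [labelLaw, lintegral_finsetSum_measure, lintegral_smul_measure]

lemma comp_labelLaw {ι : Type*} [Fintype ι] [MeasurableSpace ι] [MeasurableSingletonClass ι]
    (p : ι → ℝ) (κ : Kernel ι F) : κ ∘ₘ labelLaw p = ∑ i, ENNReal.ofReal (p i) • κ i := by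
  ext s hs
  rw [Measure.bind_apply hs κ.aemeasurable, lintegral_labelLaw, Measure.finsetSum_apply]
  rfl

lemma isGaussianMixture_comp [TopologicalSpace F] [AddCommMonoid F] [Module ℝ F] {ι : Type*}
    [Finite ι] [MeasurableSpace ι] [MeasurableSingletonClass ι] (a : Measure ι)
    [IsProbabilityMeasure a] (κ : Kernel ι F) (hκ : ∀ i, IsGaussian (κ i)) :
    IsGaussianMixture (κ ∘ₘ a) := by
  have := Fintype.ofFinite ι
  let e := Fintype.equivFin ι
  refine ⟨Fintype.card ι, fun k => a.real {e.symm k}, fun k => κ (e.symm k),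
    ⟨fun _ => measureReal_nonneg, ?_⟩, fun k => hκ _, ?_⟩
  · rw [e.symm.sum_comp fun i => a.real {i}, sum_measureReal_singleton, Finset.coe_univ,
      probReal_univ]
  · simp only [fun i => ofReal_measureReal (μ := a) (s := {i})]
    rw [e.symm.sum_comp fun i => a {i} • κ i, Measure.comp_eq_sum_of_countable, Measure.sum_fintype]

lemma isGaussianMixture_of_isGaussian [TopologicalSpace F] [AddCommMonoid F] [Module ℝ F]
    {μ : Measure F} (h : IsGaussian μ) : IsGaussianMixture μ := by
  simpa using isGaussianMixture_comp (Measure.dirac ()) (Kernel.const Unit μ) fun _ => h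

lemma isGaussianMixture_of_ae_mem_finite [NormedAddCommGroup F] [NormedSpace ℝ F] [BorelSpace F]
    {μ : Measure F} [IsProbabilityMeasure μ] {s : Set F} (hs : s.Finite) (h : ∀ᵐ x ∂μ, x ∈ s) :
    IsGaussianMixture μ := by
  have : Finite s := hs
  have hμ : (μ.comap ((↑) : s → F)).map ((↑) : s → F) = μ := by
    rw [map_comap_subtype_coe hs.measurableSet, Measure.restrict_eq_self_of_ae_mem h]
  have := MeasurableEmbedding.isProbabilityMeasure_comap (μ := μ) (.subtype_coe hs.measurableSet)
    (by simpa using h)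
  rw [← hμ, ← Measure.deterministic_comp_eq_map measurable_subtype_coe]
  refine isGaussianMixture_comp _ _ fun x => ?_
  rw [Kernel.deterministic_apply]
  infer_instance

lemma IsGaussianMixture.isProbabilityMeasure [TopologicalSpace F] [AddCommMonoid F] [Module ℝ F]
    {μ : Measure F} (h : IsGaussianMixture μ) : IsProbabilityMeasure μ := by
  obtain ⟨K, p, c, hp, hc, rfl⟩ := h
  have := isProbabilityMeasure_labelLaw hp
  have : IsMarkovKernel (Kernel.ofFunOfCountable c) := ⟨fun k => (hc k).toIsProbabilityMeasure⟩
  exact comp_labelLaw p (Kernel.ofFunOfCountable c) ▸ inferInstance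

lemma IsGaussianMixture.memLp_two_id [NormedAddCommGroup F] [NormedSpace ℝ F] [CompleteSpace F]
    [SecondCountableTopology F] [BorelSpace F] {μ : Measure F} (h : IsGaussianMixture μ) :
    MemLp id 2 μ := by
  obtain ⟨K, p, c, -, hc, rfl⟩ := h
  rw [memLp_two_iff_integrable_sq_norm (by fun_prop), integrable_finsetSum_measure]
  exact fun k _ => (IsGaussian.memLp_two_id.integrable_norm_pow two_ne_zero).smul_measure
    ENNReal.ofReal_ne_top

lemma IsGaussianMixture.map_add_const {G : Type*} [NormedAddCommGroup F] [NormedSpace ℝ F]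
    [BorelSpace F] [NormedAddCommGroup G] [NormedSpace ℝ G] [MeasurableSpace G]
    [BorelSpace G] {μ : Measure F} (hμ : IsGaussianMixture μ) (A : F →L[ℝ] G) (b : G) :
    IsGaussianMixture (μ.map fun x => A x + b) := by
  obtain ⟨K, p, c, hp, hc, rfl⟩ := hμ
  refine ⟨K, p, fun k => (c k).map fun x => A x + b, hp, fun k => ?_, ?_⟩
  · have : IsGaussian (((c k).map A).map (· + b)) := inferInstance
    rwa [Measure.map_map (by fun_prop) (by fun_prop)] at this
  · simp only [Measure.map_finset_sum' (f := fun x => A x + b) (by fun_prop), Measure.map_smul]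

lemma IsGaussianMixture.map_graph [NormedAddCommGroup F] [NormedSpace ℝ F] [FiniteDimensional ℝ F]
    [BorelSpace F] {μ : Measure F} (hμ : IsGaussianMixture μ) (T : F →ᵃ[ℝ] F) :
    IsGaussianMixture (μ.map fun x => (x, T x)) := by
  have := FiniteDimensional.proper ℝ F
  have hgraph : (fun x => (x, T x)) = fun x =>
      (ContinuousLinearMap.id ℝ F).prod T.linear.toContinuousLinearMap x + (0, T 0) := by
    ext1 x
    rw [T.decomp]
    simp
  exact hgraph ▸ hμ.map_add_const _ _

lemma IsDiracMixture.exists_finite_ae_mem [MeasurableSingletonClass F] {μ : Measure F}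
    (h : IsDiracMixture μ) : ∃ s : Set F, s.Finite ∧ ∀ᵐ x ∂μ, x ∈ s := by
  obtain ⟨K, p, y, -, rfl⟩ := h
  refine ⟨Set.range y, Set.finite_range y, ?_⟩
  have hdirac (k : Fin K) : (Measure.dirac (y k)) (Set.range y)ᶜ = 0 := by
    rw [Measure.dirac_apply' _ (Set.finite_range y).measurableSet.compl]
    simp
  rw [ae_iff, Measure.finsetSum_apply]
  exact Finset.sum_eq_zero fun k _ => by
    rw [Measure.smul_apply, smul_eq_mul, ← Set.compl_def, hdirac, mul_zero]

theorem IsCoupling.isGaussianMixture_of_isDiracMixture {E : Type*} [NormedAddCommGroup E]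
    [NormedSpace ℝ E] [MeasurableSpace E] [BorelSpace E] [SecondCountableTopology E]
    {μ ν : Measure E} {γ : Measure (E × E)} [IsProbabilityMeasure γ] (hγ : IsCoupling γ μ ν)
    (hμ : IsDiracMixture μ) (hν : IsDiracMixture ν) : IsGaussianMixture γ := by
  obtain ⟨s, hs, hsμ⟩ := hμ.exists_finite_ae_mem
  obtain ⟨t, ht, htν⟩ := hν.exists_finite_ae_mem
  refine isGaussianMixture_of_ae_mem_finite (hs.prod ht) ?_
  filter_upwards [hγ.ae_fst hsμ, hγ.ae_snd htν] with z hzs hzt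
  exact ⟨hzs, hzt⟩

end Mixtures

section Wasserstein

variable {d : ℕ} {μ ν : Measure (EuclideanSpace ℝ (Fin d))}

lemma quadCost_eq_lintegral_ofReal
    (γ : Measure (EuclideanSpace ℝ (Fin d) × EuclideanSpace ℝ (Fin d))) :
    quadCost γ = ∫⁻ z, ENNReal.ofReal (‖z.1 - z.2‖ ^ 2) ∂γ := by
  simp only [quadCost, ENNReal.ofReal_pow (norm_nonneg _), ofReal_norm]

lemma quadCost_rpow_half (γ : Measure (EuclideanSpace ℝ (Fin d) × EuclideanSpace ℝ (Fin d))) :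
    quadCost γ ^ (1 / 2 : ℝ) = eLpNorm (fun z => z.1 - z.2) 2 γ := by
  simp [quadCost, eLpNorm_eq_lintegral_rpow_enorm_toReal two_ne_zero ENNReal.ofNat_ne_top]

lemma le_W2 {a : ℝ≥0∞} (h : ∀ γ, IsCoupling γ μ ν → a ≤ quadCost γ ^ (1 / 2 : ℝ)) :
    a ≤ W2 μ ν := by
  simp only [one_div, ENNReal.le_rpow_inv_iff two_pos] at h
  rw [W2, one_div, ENNReal.le_rpow_inv_iff two_pos]
  exact le_iInf₂ h

lemma W2_le {γ : Measure (EuclideanSpace ℝ (Fin d) × EuclideanSpace ℝ (Fin d))}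
    (h : IsCoupling γ μ ν) : W2 μ ν ≤ quadCost γ ^ (1 / 2 : ℝ) :=
  ENNReal.rpow_le_rpow (iInf₂_le γ h) one_half_pos.le

lemma MW2_le {γ : Measure (EuclideanSpace ℝ (Fin d) × EuclideanSpace ℝ (Fin d))}
    (h : IsCoupling γ μ ν) (hγ : IsGaussianMixture γ) : MW2 μ ν ≤ quadCost γ ^ (1 / 2 : ℝ) :=
  ENNReal.rpow_le_rpow (iInf₂_le γ ⟨h, hγ⟩) one_half_pos.le

lemma W2_le_MW2 : W2 μ ν ≤ MW2 μ ν :=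
  ENNReal.rpow_le_rpow (le_iInf₂ fun γ hγ => iInf₂_le γ hγ.1) one_half_pos.le

lemma W2_eq_MW2_of_forall_exists
    (h : ∀ γ, IsCoupling γ μ ν →
      ∃ γ', IsCoupling γ' μ ν ∧ IsGaussianMixture γ' ∧ quadCost γ' ≤ quadCost γ) :
    W2 μ ν = MW2 μ ν := by
  refine le_antisymm W2_le_MW2 (le_W2 fun γ hγ => ?_)
  obtain ⟨γ', hγ', hmix, hcost⟩ := h γ hγ
  exact (MW2_le hγ' hmix).trans (ENNReal.rpow_le_rpow hcost one_half_pos.le)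

lemma W2_ne_top [IsProbabilityMeasure μ] [IsProbabilityMeasure ν] (hμ : MemLp id 2 μ)
    (hν : MemLp id 2 ν) : W2 μ ν ≠ ∞ := by
  have hprod : MemLp id 2 (μ.prod ν) := isCoupling_prod.memLp_id hμ hν
  refine ne_top_of_le_ne_top ?_ (W2_le isCoupling_prod)
  rw [quadCost_rpow_half]
  exact (hprod.fst.sub hprod.snd).eLpNorm_ne_top

lemma eLpNorm_compProd_comp_posterior {ι : Type*} [MeasurableSpace ι] [StandardBorelSpace ι]
    [Nonempty ι] (a : Measure ι) [IsFiniteMeasure a]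
    (κ : Kernel ι (EuclideanSpace ℝ (Fin d))) [IsFiniteKernel κ] :
    eLpNorm (fun z => z.1 - z.2) 2 ((κ ∘ₘ a) ⊗ₘ (κ ∘ₖ κ†a))
      = (∫⁻ i, quadCost ((κ i).prod (κ i)) ∂a) ^ (1 / 2 : ℝ) := by
  rw [compProd_comp_posterior, ← quadCost_rpow_half, quadCost,
    Measure.lintegral_bind (Kernel.aemeasurable _) (by fun_prop)]
  simp only [Kernel.prod_apply, quadCost]

theorem MW2_comp_le {ι ι' : Type*} [Finite ι] [MeasurableSpace ι] [MeasurableSingletonClass ι]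
    [Finite ι'] [MeasurableSpace ι'] [MeasurableSingletonClass ι'] (a : Measure ι)
    [IsProbabilityMeasure a] (b : Measure ι') [IsProbabilityMeasure b]
    (κ : Kernel ι (EuclideanSpace ℝ (Fin d))) (η : Kernel ι' (EuclideanSpace ℝ (Fin d)))
    (hκ : ∀ i, IsGaussian (κ i)) (hη : ∀ j, IsGaussian (η j)) :
    MW2 (κ ∘ₘ a) (η ∘ₘ b) ≤ W2 (κ ∘ₘ a) (η ∘ₘ b)
      + ((∫⁻ i, quadCost ((κ i).prod (κ i)) ∂a) ^ (1 / 2 : ℝ)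
        + (∫⁻ j, quadCost ((η j).prod (η j)) ∂b) ^ (1 / 2 : ℝ)) := by
  have : Nonempty ι := a.nonempty_of_neZero
  have : Nonempty ι' := b.nonempty_of_neZero
  have : IsMarkovKernel κ := ⟨fun i => (hκ i).toIsProbabilityMeasure⟩
  have : IsMarkovKernel η := ⟨fun j => (hη j).toIsProbabilityMeasure⟩
  rw [← tsub_le_iff_right]
  refine le_W2 fun γ hγ => ?_
  rw [tsub_le_iff_right]
  have := hγ.isProbabilityMeasure
  have hcoupling : IsCoupling (((κ ∘ₖ κ†a) ∥ₖ (η ∘ₖ η†b)) ∘ₘ γ) (κ ∘ₘ a) (η ∘ₘ b) := by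
    simpa only [comp_comp_posterior] using hγ.parallelComp_comp (κ ∘ₖ κ†a) (η ∘ₖ η†b)
  have hmix : IsGaussianMixture (((κ ∘ₖ κ†a) ∥ₖ (η ∘ₖ η†b)) ∘ₘ γ) := by
    rw [← Kernel.parallelComp_comp_parallelComp, ← Measure.comp_assoc]
    refine isGaussianMixture_comp _ _ fun ij => ?_
    rw [Kernel.parallelComp_apply]
    infer_instance
  refine (MW2_le hcoupling hmix).trans ?_
  rw [quadCost_rpow_half, quadCost_rpow_half, ← eLpNorm_compProd_comp_posterior a,
    ← eLpNorm_compProd_comp_posterior b, ← hγ.1, ← hγ.2]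
  exact eLpNorm_sub_parallelComp_comp_le one_le_two γ _ _

end Wasserstein

section SecondOrder

variable {F : Type*} [NormedAddCommGroup F] [NormedSpace ℝ F] [MeasurableSpace F]

/-- `μ` and `ν` have the same mean and the same covariance. Both are tested against continuous
linear forms, which avoids choosing coordinates; by polarization the variances of all linear forms
determine the covariance. -/
def HaveSameMeanCov (μ ν : Measure F) : Prop :=
  ∀ L : StrongDual ℝ F, μ[L] = ν[L] ∧ Var[L; μ] = Var[L; ν]

variable [BorelSpace F] {μ ν : Measure F}

lemma HaveSameMeanCov.map {G : Type*} [NormedAddCommGroup G] [NormedSpace ℝ G] [MeasurableSpace G]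
    [BorelSpace G] (h : HaveSameMeanCov μ ν) (A : F →L[ℝ] G) :
    HaveSameMeanCov (μ.map A) (ν.map A) := by
  intro L
  rw [integral_map (by fun_prop) (by fun_prop), integral_map (by fun_prop) (by fun_prop),
    variance_map (by fun_prop) (by fun_prop), variance_map (by fun_prop) (by fun_prop)]
  exact h (L.comp A)

lemma HaveSameMeanCov.eq_of_isGaussian [SecondCountableTopology F] [CompleteSpace F] [IsGaussian μ]
    [IsGaussian ν] (h : HaveSameMeanCov μ ν) : μ = ν := by
  refine Measure.ext_of_charFunDual (funext fun L => ?_)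
  rw [IsGaussian.charFunDual_eq, IsGaussian.charFunDual_eq, integral_complex_ofReal,
    integral_complex_ofReal, (h L).1, (h L).2]

lemma covarianceBilin_multivariateGaussian_toMatrix {ι : Type*} [Fintype ι] [DecidableEq ι]
    (γ : Measure (EuclideanSpace ℝ ι)) (m x y : EuclideanSpace ℝ ι) :
    covarianceBilin (multivariateGaussian m ((covarianceBilin γ).toBilinForm.toMatrix
      (EuclideanSpace.basisFun ι ℝ).toBasis)) x y = covarianceBilin γ x y := by
  have hS : ((covarianceBilin γ).toBilinForm.toMatrix
      (EuclideanSpace.basisFun ι ℝ).toBasis).PosSemidef :=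
    (LinearMap.isPosSemidef_iff_posSemidef_toMatrix _).1
      (LinearMap.BilinForm.isPosSemidef_iff.1 isPosSemidef_covarianceBilin)
  rw [covarianceBilin_multivariateGaussian hS]
  exact ((covarianceBilin γ).toBilinForm.apply_eq_dotProduct_toMatrix_mulVec
    (EuclideanSpace.basisFun ι ℝ).toBasis x y).symm

lemma exists_isGaussian_haveSameMeanCov_euclideanSpace {ι : Type*} [Fintype ι]
    {γ : Measure (EuclideanSpace ℝ ι)} [IsProbabilityMeasure γ] (hγ : MemLp id 2 γ) :
    ∃ γ', IsGaussian γ' ∧ HaveSameMeanCov γ' γ := by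
  classical
  let γ' := multivariateGaussian (∫ x, x ∂γ)
    ((covarianceBilin γ).toBilinForm.toMatrix (EuclideanSpace.basisFun ι ℝ).toBasis)
  refine ⟨γ', inferInstance, fun L => ⟨?_, ?_⟩⟩
  · rw [IsGaussian.integral_dual, integral_id_multivariateGaussian]
    exact (L.integral_comp_id_comm (hγ.integrable one_le_two)).symm
  · obtain ⟨x, rfl⟩ := (InnerProductSpace.toDual ℝ _).surjective L
    have h := covarianceBilin_multivariateGaussian_toMatrix γ (∫ x, x ∂γ) x x
    rwa [covarianceBilin_self IsGaussian.memLp_two_id, covarianceBilin_self hγ] at h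

theorem exists_isGaussian_haveSameMeanCov [FiniteDimensional ℝ F] [IsProbabilityMeasure μ]
    (hμ : MemLp id 2 μ) : ∃ μ', IsGaussian μ' ∧ HaveSameMeanCov μ' μ := by
  let e : F →L[ℝ] EuclideanSpace ℝ (Fin (Module.finrank ℝ F)) := toEuclidean (E := F)
  let e' : EuclideanSpace ℝ (Fin (Module.finrank ℝ F)) →L[ℝ] F := (toEuclidean (E := F)).symm
  have : IsProbabilityMeasure (μ.map e) :=
    Measure.isProbabilityMeasure_map e.continuous.measurable.aemeasurable
  obtain ⟨γ, hγ, h⟩ := exists_isGaussian_haveSameMeanCov_euclideanSpace (γ := μ.map e)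
    ((memLp_map_measure_iff (by fun_prop) (by fun_prop)).2 (e.comp_memLp' hμ))
  have hback : (μ.map e).map e' = μ := by
    have hid : e' ∘ e = id := funext (toEuclidean (E := F)).symm_apply_apply
    rw [Measure.map_map (by fun_prop) (by fun_prop), hid, Measure.map_id]
  exact ⟨γ.map e', inferInstance, hback ▸ h.map e'⟩

end SecondOrder

section GaussianCost

variable {d : ℕ}

/-- The `i`-th coordinate of the displacement `y₀ - y₁`, as a continuous linear form. -/
noncomputable def displacementCoord (i : Fin d) :
    StrongDual ℝ (EuclideanSpace ℝ (Fin d) × EuclideanSpace ℝ (Fin d)) :=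
  (EuclideanSpace.proj i).comp (.fst ℝ _ _ - .snd ℝ _ _)

lemma quadCost_eq_sum_variance
    {γ : Measure (EuclideanSpace ℝ (Fin d) × EuclideanSpace ℝ (Fin d))} [IsProbabilityMeasure γ]
    (hγ : MemLp id 2 γ) :
    quadCost γ = ENNReal.ofReal
      (∑ i, (Var[displacementCoord i; γ] + γ[displacementCoord i] ^ 2)) := by
  have hcoord (i : Fin d) : MemLp (displacementCoord i) 2 γ := (displacementCoord i).comp_memLp' hγ
  have hsq (z : EuclideanSpace ℝ (Fin d) × EuclideanSpace ℝ (Fin d)) :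
      ‖z.1 - z.2‖ ^ 2 = ∑ i, displacementCoord i z ^ 2 := EuclideanSpace.real_norm_sq_eq _
  have hmoment (i : Fin d) : Var[displacementCoord i; γ] + γ[displacementCoord i] ^ 2
      = ∫ z, displacementCoord i z ^ 2 ∂γ := by
    rw [variance_eq_sub (hcoord i), sub_add_cancel]
    rfl
  simp only [quadCost_eq_lintegral_ofReal, hsq, hmoment]
  rw [← integral_finsetSum _ fun i _ => (hcoord i).integrable_sq,
    ofReal_integral_eq_lintegral_ofReal
      (integrable_finsetSum _ fun i _ => (hcoord i).integrable_sq)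
      (ae_of_all _ fun z => Finset.sum_nonneg fun i _ => sq_nonneg _)]

theorem exists_isGaussian_coupling_quadCost_eq {μ ν : Measure (EuclideanSpace ℝ (Fin d))}
    [IsGaussian μ] [IsGaussian ν]
    {γ : Measure (EuclideanSpace ℝ (Fin d) × EuclideanSpace ℝ (Fin d))} (hγ : IsCoupling γ μ ν) :
    ∃ γ', IsCoupling γ' μ ν ∧ IsGaussian γ' ∧ quadCost γ' = quadCost γ := by
  have := hγ.isProbabilityMeasure
  have hγ₂ : MemLp id 2 γ := hγ.memLp_id IsGaussian.memLp_two_id IsGaussian.memLp_two_id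
  obtain ⟨γ', hG, h⟩ := exists_isGaussian_haveSameMeanCov hγ₂
  let fst := ContinuousLinearMap.fst ℝ (EuclideanSpace ℝ (Fin d)) (EuclideanSpace ℝ (Fin d))
  let snd := ContinuousLinearMap.snd ℝ (EuclideanSpace ℝ (Fin d)) (EuclideanSpace ℝ (Fin d))
  have hfst : HaveSameMeanCov (γ'.map fst) μ := hγ.1 ▸ h.map fst
  have hsnd : HaveSameMeanCov (γ'.map snd) ν := hγ.2 ▸ h.map snd
  refine ⟨γ', ⟨hfst.eq_of_isGaussian, hsnd.eq_of_isGaussian⟩, hG, ?_⟩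
  rw [quadCost_eq_sum_variance hγ₂, quadCost_eq_sum_variance IsGaussian.memLp_two_id]
  simp only [(h _).1, (h _).2]

lemma quadCost_prod_self {μ : Measure (EuclideanSpace ℝ (Fin d))} [IsProbabilityMeasure μ]
    (hμ : MemLp id 2 μ) : quadCost (μ.prod μ) = ENNReal.ofReal (2 * ∑ i, Var[fun x => x i; μ]) := by
  have hprod : MemLp id 2 (μ.prod μ) := isCoupling_prod.memLp_id hμ hμ
  rw [quadCost_eq_sum_variance hprod, Finset.mul_sum]
  congr 1
  refine Finset.sum_congr rfl fun i _ => ?_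
  have hinl : (displacementCoord i).comp (.inl ℝ (EuclideanSpace ℝ (Fin d)) _)
      = EuclideanSpace.proj i := by
    ext x; simp [displacementCoord]
  have hinr : (displacementCoord i).comp (.inr ℝ (EuclideanSpace ℝ (Fin d)) _)
      = -EuclideanSpace.proj i := by
    ext x; simp [displacementCoord]
  have hint : Integrable id μ := hμ.integrable one_le_two
  have hmean : (μ.prod μ)[displacementCoord i] = 0 := by
    rw [integral_continuousLinearMap_prod hint hint, hinl, hinr]
    simp [integral_neg]
  rw [variance_dual_prod hμ hμ, hmean, hinl, hinr]
  simp only [FunLike.coe_neg, variance_neg]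
  change Var[fun x => x i; μ] + Var[fun x => x i; μ] + _ = _
  ring

lemma quadCost_multivariateGaussian_prod_self (m : EuclideanSpace ℝ (Fin d))
    {S : Matrix (Fin d) (Fin d) ℝ} (hS : S.PosSemidef) :
    quadCost ((multivariateGaussian m S).prod (multivariateGaussian m S))
      = ENNReal.ofReal (2 * S.trace) := by
  simp only [quadCost_prod_self IsGaussian.memLp_two_id, variance_eval_multivariateGaussian hS,
    Matrix.trace, Matrix.diag_apply]

end GaussianCost

section Duality

variable {E : Type*} [MeasurableSpace E] {μ ν : Measure E} {γ γ₀ : Measure (E × E)} {f g : E → ℝ}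

lemma IsCoupling.integrable_add (h : IsCoupling γ μ ν) (hf : Integrable f μ) (hg : Integrable g ν) :
    Integrable (fun z => f z.1 + g z.2) γ := by
  rw [← h.1] at hf
  rw [← h.2] at hg
  exact (hf.comp_measurable measurable_fst).add (hg.comp_measurable measurable_snd)

lemma IsCoupling.integral_add (h : IsCoupling γ μ ν) (hf : Integrable f μ) (hg : Integrable g ν) :
    ∫ z, f z.1 + g z.2 ∂γ = ∫ x, f x ∂μ + ∫ y, g y ∂ν := by
  rw [← h.1] at hf ⊢
  rw [← h.2] at hg ⊢
  rw [integral_map measurable_fst.aemeasurable hf.1, integral_map measurable_snd.aemeasurable hg.1]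
  exact MeasureTheory.integral_add (hf.comp_measurable measurable_fst)
    (hg.comp_measurable measurable_snd)

lemma ofReal_integral_le_lintegral_ofReal {Ω : Type*} [MeasurableSpace Ω] {π : Measure Ω}
    {u : Ω → ℝ} (hu : Integrable u π) :
    ENNReal.ofReal (∫ x, u x ∂π) ≤ ∫⁻ x, ENNReal.ofReal (u x) ∂π := by
  rw [integral_eq_lintegral_pos_part_sub_lintegral_neg_part hu]
  exact (ENNReal.ofReal_le_ofReal (sub_le_self _ ENNReal.toReal_nonneg)).trans
    ENNReal.ofReal_toReal_le

theorem IsCoupling.lintegral_le_of_potentials (h₀ : IsCoupling γ₀ μ ν) (h : IsCoupling γ μ ν)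
    (hf : Integrable f μ) (hg : Integrable g ν) {c : E × E → ℝ} (hc : ∀ z, 0 ≤ c z)
    (heq : ∀ᵐ z ∂γ₀, f z.1 + g z.2 = c z) (hle : ∀ᵐ z ∂γ, f z.1 + g z.2 ≤ c z) :
    ∫⁻ z, ENNReal.ofReal (c z) ∂γ₀ ≤ ∫⁻ z, ENNReal.ofReal (c z) ∂γ := by
  have hint := h₀.integrable_add hf hg
  calc ∫⁻ z, ENNReal.ofReal (c z) ∂γ₀
    _ = ENNReal.ofReal (∫ z, f z.1 + g z.2 ∂γ₀) := by
      rw [integral_congr_ae heq, ofReal_integral_eq_lintegral_ofReal (hint.congr heq)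
        (ae_of_all _ hc)]
    _ = ENNReal.ofReal (∫ z, f z.1 + g z.2 ∂γ) := by
      rw [h₀.integral_add hf hg, h.integral_add hf hg]
    _ ≤ ∫⁻ z, ENNReal.ofReal (f z.1 + g z.2) ∂γ :=
      ofReal_integral_le_lintegral_ofReal (h.integrable_add hf hg)
    _ ≤ ∫⁻ z, ENNReal.ofReal (c z) ∂γ :=
      lintegral_mono_ae (hle.mono fun _ hz => ENNReal.ofReal_le_ofReal hz)

end Duality

lemma exists_linearMap_comp_comp_eq_self {K V W : Type*} [Field K] [AddCommGroup V] [Module K V]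
    [AddCommGroup W] [Module K W] (A : V →ₗ[K] W) : ∃ B : W →ₗ[K] V, ∀ x, A (B (A x)) = A x := by
  obtain ⟨s, hs⟩ := A.rangeRestrict.exists_rightInverse_of_surjective A.range_rangeRestrict
  obtain ⟨B, hB⟩ := LinearMap.exists_extend s
  refine ⟨B, fun x => ?_⟩
  have hBA : B (A x) = s (A.rangeRestrict x) := LinearMap.congr_fun hB (A.rangeRestrict x)
  rw [hBA]
  exact congrArg Subtype.val (LinearMap.congr_fun hs (A.rangeRestrict x))

section QuadraticPotentials

variable {E : Type*} [NormedAddCommGroup E] [InnerProductSpace ℝ E]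

/-- The potential `‖x‖² - 2 φ(x)` on the source of `x ↦ A x + b`, which is the gradient of
`φ(x) = ⟪A x, x⟫ / 2 + ⟪b, x⟫` when `A` is symmetric. -/
def sourcePotential (A : E →ₗ[ℝ] E) (b x : E) : ℝ :=
  ‖x‖ ^ 2 - inner ℝ (A x) x - 2 * inner ℝ b x

/-- The potential `‖y‖² - 2 φ*(y)` on the target of `x ↦ A x + b`. Here `B` is a generalized inverse
of `A`, and the Legendre transform `φ*` of `φ` is taken to be `⟪B (y - b), y - b⟫ / 2`, which is its
value on the range of `x ↦ A x + b`. -/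
def targetPotential (B : E →ₗ[ℝ] E) (b y : E) : ℝ :=
  ‖y‖ ^ 2 - inner ℝ (B (y - b)) (y - b)

lemma sourcePotential_add_targetPotential {A B : E →ₗ[ℝ] E} (hA : A.IsSymmetric)
    (hB : ∀ x, A (B (A x)) = A x) (b x x' : E) :
    sourcePotential A b x + targetPotential B b (A x' + b)
      = ‖x - (A x' + b)‖ ^ 2 - inner ℝ (A (x - x')) (x - x') := by
  have hAB : inner ℝ (B (A x')) (A x') = inner ℝ (A x') x' := by
    rw [← hA, hB]
  have hsymm : inner ℝ (A x) x' = inner ℝ (A x') x := by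
    rw [hA, real_inner_comm]
  simp only [sourcePotential, targetPotential, add_sub_cancel_right, hAB, norm_sub_sq_real, map_sub,
    inner_sub_left, inner_sub_right, inner_add_right, hsymm, real_inner_comm x]
  rw [real_inner_comm b x, real_inner_comm (A x') x]
  ring

lemma integrable_inner_of_memLp_two {Ω : Type*} [MeasurableSpace Ω] {μ : Measure Ω} {u v : Ω → E}
    (hu : MemLp u 2 μ) (hv : MemLp v 2 μ) : Integrable (fun x => inner ℝ (u x) (v x)) μ := by
  refine (hu.norm.integrable_mul hv.norm).mono (hu.1.inner hv.1) (ae_of_all _ fun x => ?_)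
  simpa using abs_real_inner_le_norm (u x) (v x)

variable [FiniteDimensional ℝ E] [MeasurableSpace E] {μ : Measure E} [IsFiniteMeasure μ]

lemma integrable_sourcePotential (hμ : MemLp id 2 μ) (A : E →ₗ[ℝ] E) (b : E) :
    Integrable (sourcePotential A b) μ :=
  ((hμ.integrable_norm_pow two_ne_zero).sub (integrable_inner_of_memLp_two
    (A.toContinuousLinearMap.comp_memLp' hμ) hμ)).sub
    ((integrable_inner_of_memLp_two (memLp_const b) hμ).const_mul 2)

lemma integrable_targetPotential (hμ : MemLp id 2 μ) (B : E →ₗ[ℝ] E) (b : E) :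
    Integrable (targetPotential B b) μ := by
  have hsub : MemLp (fun y => y - b) 2 μ := hμ.sub (memLp_const b)
  exact (hμ.integrable_norm_pow two_ne_zero).sub
    (integrable_inner_of_memLp_two (B.toContinuousLinearMap.comp_memLp' hsub) hsub)

end QuadraticPotentials

section AffineMaps

lemma memLp_id_map_affineMap {E : Type*} [NormedAddCommGroup E] [NormedSpace ℝ E]
    [FiniteDimensional ℝ E] [MeasurableSpace E] [BorelSpace E] {μ : Measure E} [IsFiniteMeasure μ]
    {p : ℝ≥0∞} (hμ : MemLp id p μ) (T : E →ᵃ[ℝ] E) : MemLp id p (μ.map T) := by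
  have := FiniteDimensional.proper ℝ E
  have hT : Measurable T := T.continuous_of_finiteDimensional.measurable
  rw [memLp_map_measure_iff (by fun_prop) (by fun_prop), Function.id_comp, T.decomp]
  exact (T.linear.toContinuousLinearMap.comp_memLp' hμ).add (memLp_const (T 0))

variable {d : ℕ}

theorem quadCost_graph_le {μ : Measure (EuclideanSpace ℝ (Fin d))} [IsFiniteMeasure μ]
    (hμ : MemLp id 2 μ) {T : EuclideanSpace ℝ (Fin d) →ᵃ[ℝ] EuclideanSpace ℝ (Fin d)}
    (hT : T.linear.IsPositive)
    {γ : Measure (EuclideanSpace ℝ (Fin d) × EuclideanSpace ℝ (Fin d))}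
    (hγ : IsCoupling γ μ (μ.map T)) : quadCost (μ.map fun x => (x, T x)) ≤ quadCost γ := by
  obtain ⟨B, hB⟩ := exists_linearMap_comp_comp_eq_self T.linear
  have hTx (x) : T x = T.linear x + T 0 := congrFun T.decomp x
  have hTmeas : Measurable T := T.continuous_of_finiteDimensional.measurable
  have hBmeas : Measurable B := B.continuous_of_finiteDimensional.measurable
  have hpot (x x') : sourcePotential T.linear (T 0) x + targetPotential B (T 0) (T x')
      = ‖x - T x'‖ ^ 2 - inner ℝ (T.linear (x - x')) (x - x') := by
    rw [hTx x', sourcePotential_add_targetPotential hT.isSymmetric hB]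
  have hrange : ∀ᵐ y ∂(μ.map T), T (B (y - T 0)) = y := by
    rw [ae_map_iff hTmeas.aemeasurable (measurableSet_eq_fun (by fun_prop) (by fun_prop))]
    refine ae_of_all _ fun x => ?_
    rw [hTx x, add_sub_cancel_right, hTx, hB]
  have hgraph : ∀ᵐ z ∂(μ.map fun x => (x, T x)), z.2 = T z.1 := by
    rw [ae_map_iff (by fun_prop) (measurableSet_eq_fun (by fun_prop) (by fun_prop))]
    exact ae_of_all _ fun x => rfl
  rw [quadCost_eq_lintegral_ofReal, quadCost_eq_lintegral_ofReal]
  refine (isCoupling_graph hTmeas).lintegral_le_of_potentials hγ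
    (integrable_sourcePotential hμ T.linear (T 0))
    (integrable_targetPotential (memLp_id_map_affineMap hμ T) B (T 0))
    (fun z => by positivity) ?_ ?_
  · filter_upwards [hgraph] with z hz
    rw [hz, hpot, sub_self, map_zero, inner_zero_left, sub_zero]
  · filter_upwards [hγ.ae_snd hrange] with z hz
    have hnonneg := hT.inner_nonneg_left (z.1 - B (z.2 - T 0))
    rw [← hz, hpot, hz]
    linarith

end AffineMaps

section GaussianMixtures

variable {d K : ℕ} {p : Fin K → ℝ} {m : Fin K → EuclideanSpace ℝ (Fin d)}
  {S : Fin K → Matrix (Fin d) (Fin d) ℝ}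

lemma isGaussianMixture_gaussianMixture (hp : p ∈ stdSimplex ℝ (Fin K)) :
    IsGaussianMixture (gaussianMixture p m S) :=
  ⟨K, p, _, hp, fun _ => isGaussian_multivariateGaussian, rfl⟩

lemma rpow_half_lintegral_labelLaw_quadCost (hp : p ∈ stdSimplex ℝ (Fin K))
    (hS : ∀ k, (S k).PosSemidef) :
    (∫⁻ k, quadCost ((multivariateGaussian (m k) (S k)).prod (multivariateGaussian (m k) (S k)))
        ∂(labelLaw p)) ^ (1 / 2 : ℝ)
      = ENNReal.ofReal √(2 * ∑ k, p k * (S k).trace) := by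
  have hnonneg (k : Fin K) : 0 ≤ p k * (2 * (S k).trace) :=
    mul_nonneg (hp.1 k) (mul_nonneg zero_le_two (hS k).trace_nonneg)
  simp only [lintegral_labelLaw, quadCost_multivariateGaussian_prod_self _ (hS _),
    ← ENNReal.ofReal_mul (hp.1 _)]
  rw [← ENNReal.ofReal_sum_of_nonneg fun k _ => hnonneg k,
    ENNReal.ofReal_rpow_of_nonneg (Finset.sum_nonneg fun k _ => hnonneg k) one_half_pos.le,
    ← Real.sqrt_eq_rpow, Finset.mul_sum]
  simp only [mul_left_comm]

theorem MW2_gaussianMixture_le {K' : ℕ} {p' : Fin K' → ℝ}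
    {m' : Fin K' → EuclideanSpace ℝ (Fin d)} {S' : Fin K' → Matrix (Fin d) (Fin d) ℝ}
    (hp : p ∈ stdSimplex ℝ (Fin K)) (hS : ∀ k, (S k).PosSemidef)
    (hp' : p' ∈ stdSimplex ℝ (Fin K')) (hS' : ∀ k, (S' k).PosSemidef) :
    MW2 (gaussianMixture p m S) (gaussianMixture p' m' S')
      ≤ W2 (gaussianMixture p m S) (gaussianMixture p' m' S')
        + (ENNReal.ofReal √(2 * ∑ k, p k * (S k).trace)
          + ENNReal.ofReal √(2 * ∑ k, p' k * (S' k).trace)) := by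
  have := isProbabilityMeasure_labelLaw hp
  have := isProbabilityMeasure_labelLaw hp'
  have h := MW2_comp_le (labelLaw p) (labelLaw p')
    (Kernel.ofFunOfCountable fun k => multivariateGaussian (m k) (S k))
    (Kernel.ofFunOfCountable fun k => multivariateGaussian (m' k) (S' k))
    (fun _ => isGaussian_multivariateGaussian) (fun _ => isGaussian_multivariateGaussian)
  rw [comp_labelLaw, comp_labelLaw] at h
  rw [← rpow_half_lintegral_labelLaw_quadCost (m := m) hp hS,
    ← rpow_half_lintegral_labelLaw_quadCost (m := m') hp' hS']
  exact h

end GaussianMixtures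

theorem mainTheorem3 {d K₀ K₁ : ℕ}
    (p₀ : Fin K₀ → ℝ) (m₀ : Fin K₀ → EuclideanSpace ℝ (Fin d))
    (S₀ : Fin K₀ → Matrix (Fin d) (Fin d) ℝ)
    (p₁ : Fin K₁ → ℝ) (m₁ : Fin K₁ → EuclideanSpace ℝ (Fin d))
    (S₁ : Fin K₁ → Matrix (Fin d) (Fin d) ℝ)
    (hp₀ : p₀ ∈ stdSimplex ℝ (Fin K₀)) (hS₀ : ∀ k, (S₀ k).PosSemidef)
    (hp₁ : p₁ ∈ stdSimplex ℝ (Fin K₁)) (hS₁ : ∀ k, (S₁ k).PosSemidef)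
    (μ₀ μ₁ : Measure (EuclideanSpace ℝ (Fin d)))
    (hμ₀ : μ₀ = gaussianMixture p₀ m₀ S₀) (hμ₁ : μ₁ = gaussianMixture p₁ m₁ S₁) :
    MW2 μ₀ μ₁ ≠ ∞ ∧
    W2 μ₀ μ₁ ≤ MW2 μ₀ μ₁ ∧
    MW2 μ₀ μ₁ ≤ W2 μ₀ μ₁
      + (ENNReal.ofReal √(2 * ∑ k, p₀ k * (S₀ k).trace)
        + ENNReal.ofReal √(2 * ∑ k, p₁ k * (S₁ k).trace)) ∧
    (IsGaussian μ₀ → IsGaussian μ₁ → W2 μ₀ μ₁ = MW2 μ₀ μ₁) ∧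
    (IsDiracMixture μ₀ → IsDiracMixture μ₁ → W2 μ₀ μ₁ = MW2 μ₀ μ₁) ∧
    (∀ T : EuclideanSpace ℝ (Fin d) →ᵃ[ℝ] EuclideanSpace ℝ (Fin d),
      T.linear.IsPositive → μ₁ = μ₀.map T → W2 μ₀ μ₁ = MW2 μ₀ μ₁) := by
  have hG₀ : IsGaussianMixture μ₀ := hμ₀ ▸ isGaussianMixture_gaussianMixture hp₀
  have hG₁ : IsGaussianMixture μ₁ := hμ₁ ▸ isGaussianMixture_gaussianMixture hp₁
  have := hG₀.isProbabilityMeasure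
  have := hG₁.isProbabilityMeasure
  have hbound := hμ₀ ▸ hμ₁ ▸ MW2_gaussianMixture_le (m := m₀) (m' := m₁) hp₀ hS₀ hp₁ hS₁
  refine ⟨?_, W2_le_MW2, hbound, fun h₀ h₁ => ?_, fun h₀ h₁ => ?_, ?_⟩
  · refine ne_top_of_le_ne_top (ENNReal.add_ne_top.2 ⟨?_, ?_⟩) hbound
    · exact W2_ne_top hG₀.memLp_two_id hG₁.memLp_two_id
    · exact ENNReal.add_ne_top.2 ⟨ENNReal.ofReal_ne_top, ENNReal.ofReal_ne_top⟩
  · refine W2_eq_MW2_of_forall_exists fun γ hγ => ?_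
    obtain ⟨γ', hγ', hG, hcost⟩ := exists_isGaussian_coupling_quadCost_eq hγ
    exact ⟨γ', hγ', isGaussianMixture_of_isGaussian hG, hcost.le⟩
  · refine W2_eq_MW2_of_forall_exists fun γ hγ => ?_
    have := hγ.isProbabilityMeasure
    exact ⟨γ, hγ, hγ.isGaussianMixture_of_isDiracMixture h₀ h₁, le_rfl⟩
  · rintro T hT rfl
    exact W2_eq_MW2_of_forall_exists fun γ hγ =>
      ⟨_, isCoupling_graph T.continuous_of_finiteDimensional.measurable, hG₀.map_graph T,
        quadCost_graph_le hG₀.memLp_two_id hT hγ⟩
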